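/- For a field $K$, let $D_K$ (the minimal Dress ring of $K$) be the smallest subring of $K$ containing $1/(1+x^2)$ for every $x\in K$ such that $1+x^2\neq 0$. A valuation ring $V$ of $K$ (that is, of a valuation on $K$) with maximal ideal $\mathfrak M$ is called formally real if its residue field $F=V/\mathfrak M$ is formally real, i.e. $1+\sum_{i=1}^m x_i^2\neq 0$ for all $m \ge 0$ and $x_1,\dots,x_m\in F$. Let $R_K$ (Schülting's ring) be the intersection of all formally real valuation rings of $K$. Let $K=\mathbb R(X_1,\dots,X_n)$ be the field of rational functions in $n$ indeterminates. (i) If $n=1$, then $R_K=D_K$. (ii) If $n\ge 2$, then $R_K$ properly contains $D_K$. More precisely, the polynomial $f=1+X_1^2+\cdots+X_n^2$ is irreducible in $\mathbb R[X_1,\dots,X_n]$, there is exactly one valuation $w:K\to\mathbb Z\cup\{\infty\}$ with $w(f)=1$ and $w(g)=0$ for every $g\in\mathbb R[X_1,\dots,X_n]$ not divisible by $f$, and the valuation ring of $w$ contains $D_K$, is not formally real, and does not contain $R_K$. -/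

import Mathlib

open scoped WithZero

/-- The minimal Dress ring of a field `K`: the smallest subring of `K` (in particular it contains
the prime subring) that contains `1 / (1 + x ^ 2)` for every `x : K`. -/
def minimalDressRing (K : Type*) [Field K] : Subring K :=
  Subring.closure {y : K | ∃ x : K, y = 1 / (1 + x ^ 2)}

/-- A valuation ring `V` of `K` is formally real if its residue field `F` is a formally real field,
i.e. `1 + s ≠ 0` in `F` for every sum of squares `s` (for fields this is `IsSemireal`). -/
def ValuationSubring.FormallyReal {K : Type*} [Field K] (V : ValuationSubring K) : Prop :=
  IsSemireal (IsLocalRing.ResidueField V)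

/-- The Schülting ring of a field `K`: the intersection of all formally real valuation rings
of `K`. -/
def schultingRing (K : Type*) [Field K] : Subring K :=
  ⨅ V : {V : ValuationSubring K // V.FormallyReal}, V.1.toSubring

/-- The polynomial `1 + X₁² + ⋯ + Xₙ²` over the reals. -/
noncomputable def onePlusSumSq (n : ℕ) : MvPolynomial (Fin n) ℝ :=
  1 + ∑ i, MvPolynomial.X i ^ 2

/-- `w` is the discrete valuation of `K` determined by the element `f` of `A`: in additive notation
`w f = 1`, and `w g = 0` for all `g` in `A` not divisible by `f`. Mathlib writes valuations
multiplicatively, so that the additive values `1` and `0` become `exp (-1)` and `1`. -/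
structure IsValuationDeterminedBy {A K : Type*} [CommRing A] [Field K] [Algebra A K]
    (f : A) (w : Valuation K ℤᵐ⁰) : Prop where
  map_self : w (algebraMap A K f) = WithZero.exp (-1 : ℤ)
  map_of_not_dvd : ∀ g : A, ¬ f ∣ g → w (algebraMap A K g) = 1

/-! A valuation ring is formally real exactly when it contains `(1 + s)⁻¹` for every sum of squares
`s`, with `1 + s ≠ 0`. Hence D_K ≤ R_K, and `1 / f` lies in R_K although `w` gives it a pole.

For `n ≥ 2` it remains to see that D_K lies in the ring of `w`. A pole of `1 / (1 + x ^ 2)` at `f`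
would make -1 a square modulo `f`. Regard `f` as `X ^ 2 + p` over the polynomials in the other
variables: -1 is not a square modulo `f` because `p` is not a square
(`Polynomial.X_sq_add_C_dvd_of_dvd_sq_add_sq`).

For `n = 1`, the real places, at infinity and at each real `a`, force a reduced fraction `g / h` in
R_K to satisfy `deg g ≤ deg h` with `h` free of real zeros. Splitting off quadratic factors of `h`
writes `g / h` in terms of real constants, `1 / (1 + y ^ 2)` and `y / (1 + y ^ 2)`, all in D_K. -/

/-! ### Sums of squares and formally real valuation rings -/

theorem IsSumSq.map_ringHom {R S : Type*} [Semiring R] [Semiring S] (φ : R →+* S) {s : R}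
    (hs : IsSumSq s) : IsSumSq (φ s) := by
  induction hs with
  | zero => rw [map_zero]; exact .zero
  | sq_add a _ ih => rw [map_add, map_mul]; exact .sq_add _ ih

/-- A valuation ring with formally real residue field contains the inverses of all `1 + s` with
`s` a sum of squares. -/
theorem ValuationSubring.FormallyReal.one_add_ne_zero_and_inv_mem {K : Type*} [Field K]
    {V : ValuationSubring K} (hV : V.FormallyReal) {s : K} (hs : IsSumSq s) :
    1 + s ≠ 0 ∧ (1 + s)⁻¹ ∈ V := by
  have hunit : ∀ τ : V, IsSumSq τ → IsUnit (1 + τ) := fun τ hτ => by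
    rw [← IsLocalRing.residue_ne_zero_iff_isUnit, map_add, map_one]
    have : IsSemireal (IsLocalRing.ResidueField V) := hV
    exact IsSemireal.one_add_ne_zero (hτ.map_ringHom (IsLocalRing.residue V))
  -- Factor out the square of a dominant term `c` among 1 and the squared entries; what remains is 1
  -- plus a sum of squares inside `V`.
  have hscale : ∃ c : K, c ≠ 0 ∧ c⁻¹ ∈ V ∧ ∃ τ : V, IsSumSq τ ∧ 1 + s = c * c * (1 + τ) := by
    induction hs with
    | zero => exact ⟨1, one_ne_zero, by simp, 0, .zero, by simp⟩
    | @sq_add a s _ ih =>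
      obtain ⟨c, hc, hcV, τ, hτ, h⟩ := ih
      rcases V.mem_or_inv_mem (a / c) with hac | hac
      · refine ⟨c, hc, hcV, ⟨a / c, hac⟩ * ⟨a / c, hac⟩ + τ, .sq_add _ hτ, ?_⟩
        push_cast
        rw [add_left_comm, h]
        field_simp
        ring
      · by_cases ha : a = 0
        · exact ⟨c, hc, hcV, τ, hτ, by rw [← h, ha]; ring⟩
        · refine ⟨a, ha, ?_, ⟨(a / c)⁻¹, hac⟩ * ⟨(a / c)⁻¹, hac⟩ * (1 + τ),
            (IsSumSq.mul_self _).mul (IsSumSq.one.add hτ), ?_⟩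
          · have := V.mul_mem _ _ hac hcV
            rwa [inv_div, div_mul_eq_mul_div, mul_inv_cancel₀ hc, one_div] at this
          · push_cast
            rw [add_left_comm, h]
            field_simp
  obtain ⟨c, hc, hcV, τ, hτ, h⟩ := hscale
  obtain ⟨u, hu⟩ := hunit τ hτ
  have hu' : (1 + (τ : K)) = ((u : V) : K) := by rw [hu]; push_cast; rfl
  have huinv : ((u : V) : K) * ((u⁻¹ : Vˣ) : V) = 1 := by
    rw [← MulMemClass.coe_mul, Units.mul_inv]; rfl
  have hu0 : ((u : V) : K) ≠ 0 := left_ne_zero_of_mul_eq_one huinv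
  rw [h, hu']
  refine ⟨mul_ne_zero (mul_ne_zero hc hc) hu0, ?_⟩
  rw [mul_inv, mul_inv, inv_eq_of_mul_eq_one_right huinv]
  exact V.mul_mem _ _ (V.mul_mem _ _ hcV hcV) (SetLike.coe_mem _)

/-- A sum of squares in the residue field lifts to one in `V`, and 1 plus the lift is a unit. -/
theorem ValuationSubring.formallyReal_of_one_add_inv_mem {K : Type*} [Field K]
    {V : ValuationSubring K}
    (hV : ∀ s : K, IsSumSq s → 1 + s ≠ 0 ∧ (1 + s)⁻¹ ∈ V) : V.FormallyReal := by
  have hlift : ∀ t : IsLocalRing.ResidueField V, IsSumSq t →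
      ∃ τ : V, IsSumSq τ ∧ IsLocalRing.residue V τ = t := by
    intro t ht
    induction ht with
    | zero => exact ⟨0, .zero, map_zero _⟩
    | @sq_add a t _ ih =>
      obtain ⟨τ, hτ, rfl⟩ := ih
      obtain ⟨a, rfl⟩ := IsLocalRing.residue_surjective a
      exact ⟨a * a + τ, .sq_add _ hτ, by simp⟩
  refine ⟨fun {t} ht => ?_⟩
  obtain ⟨τ, hτ, rfl⟩ := hlift t ht
  rw [← map_one (IsLocalRing.residue V), ← map_add, IsLocalRing.residue_ne_zero_iff_isUnit]
  obtain ⟨h0, h⟩ := hV τ (hτ.map_ringHom V.subtype)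
  exact IsUnit.of_mul_eq_one ⟨_, h⟩ (Subtype.ext (mul_inv_cancel₀ h0))

theorem one_add_inv_mem_schultingRing {K : Type*} [Field K] {s : K} (hs : IsSumSq s) :
    (1 + s)⁻¹ ∈ schultingRing K := by
  rw [schultingRing, Subring.mem_iInf]
  exact fun V => (V.2.one_add_ne_zero_and_inv_mem hs).2

theorem minimalDressRing_le_schultingRing (K : Type*) [Field K] :
    minimalDressRing K ≤ schultingRing K := by
  rw [minimalDressRing, Subring.closure_le]
  rintro _ ⟨x, rfl⟩
  rw [one_div, pow_two]
  exact one_add_inv_mem_schultingRing (.mul_self x)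

/-! ### -1 is not a square modulo `1 + X₁² + ⋯ + Xₙ²` -/

theorem Polynomial.exists_eq_mul_X_sq_add_C_add {A : Type*} [CommRing A] (p : A)
    (g : Polynomial A) :
    ∃ (q : Polynomial A) (a b : A),
      g = (Polynomial.X ^ 2 + Polynomial.C p) * q +
        (Polynomial.C a + Polynomial.C b * Polynomial.X) := by
  nontriviality A
  have hm : (Polynomial.X ^ 2 + Polynomial.C p).Monic := Polynomial.monic_X_pow_add_C p two_ne_zero
  have hd : (g %ₘ (Polynomial.X ^ 2 + Polynomial.C p)).natDegree ≤ 1 := by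
    have := Polynomial.natDegree_modByMonic_lt g hm
      (fun h => by simpa [h] using Polynomial.natDegree_X_pow_add_C (n := 2) (r := p))
    rw [Polynomial.natDegree_X_pow_add_C] at this
    omega
  obtain ⟨b, a, h⟩ := Polynomial.exists_eq_X_add_C_of_natDegree_le_one hd
  refine ⟨g /ₘ (Polynomial.X ^ 2 + Polynomial.C p), a, b, ?_⟩
  conv_lhs => rw [← Polynomial.modByMonic_add_div g (Polynomial.X ^ 2 + Polynomial.C p), h]
  ring

theorem Polynomial.eq_zero_of_X_sq_add_C_dvd {A : Type*} [CommRing A] {p a b : A}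
    (h : Polynomial.X ^ 2 + Polynomial.C p ∣ Polynomial.C a + Polynomial.C b * Polynomial.X) :
    a = 0 ∧ b = 0 := by
  nontriviality A
  have hm : (Polynomial.X ^ 2 + Polynomial.C p).Monic := Polynomial.monic_X_pow_add_C p two_ne_zero
  have h0 : Polynomial.C a + Polynomial.C b * Polynomial.X = 0 := by
    by_contra h0
    refine hm.not_dvd_of_natDegree_lt h0 ?_ h
    rw [Polynomial.natDegree_X_pow_add_C, add_comm]
    exact Polynomial.natDegree_linear_le.trans_lt one_lt_two
  have ha := congrArg (Polynomial.coeff · 0) h0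
  have hb := congrArg (Polynomial.coeff · 1) h0
  simp [Polynomial.coeff_C] at ha hb
  exact ⟨ha, hb⟩

/-- If `p` is not a square and `-1` is not a quotient of squares in `A`, then `-1` is not a square in
the function field of `X ^ 2 + p`. -/
theorem Polynomial.X_sq_add_C_dvd_of_dvd_sq_add_sq {A : Type*} [CommRing A] [IsDomain A]
    [IsIntegrallyClosed A] (hA : ∀ b d : A, b ^ 2 + d ^ 2 = 0 → b = 0 ∧ d = 0) {p : A}
    (hp : ¬ IsSquare p) {g h : Polynomial A}
    (hgh : Polynomial.X ^ 2 + Polynomial.C p ∣ g ^ 2 + h ^ 2) :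
    Polynomial.X ^ 2 + Polynomial.C p ∣ g := by
  obtain ⟨q, a, b, rfl⟩ := Polynomial.exists_eq_mul_X_sq_add_C_add p g
  obtain ⟨r, c, d, rfl⟩ := Polynomial.exists_eq_mul_X_sq_add_C_add p h
  have hrem : Polynomial.X ^ 2 + Polynomial.C p ∣
      Polynomial.C (a ^ 2 + c ^ 2 - p * (b ^ 2 + d ^ 2)) +
        Polynomial.C (2 * (a * b + c * d)) * Polynomial.X := by
    refine (dvd_add_right (a := Polynomial.X ^ 2 + Polynomial.C p) (Dvd.intro
      ((Polynomial.X ^ 2 + Polynomial.C p) * (q ^ 2 + r ^ 2) +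
        2 * q * (Polynomial.C a + Polynomial.C b * Polynomial.X) +
        2 * r * (Polynomial.C c + Polynomial.C d * Polynomial.X) +
        Polynomial.C (b ^ 2 + d ^ 2)) rfl)).1 (hgh.trans (dvd_of_eq ?_))
    simp only [map_add, map_sub, map_mul, map_pow, map_ofNat]
    ring
  obtain ⟨h1, h2⟩ := Polynomial.eq_zero_of_X_sq_add_C_dvd hrem
  have h2' : a * b + c * d = 0 := by
    have h20 : (2 : A) ≠ 0 := fun h20 =>
      one_ne_zero (hA 1 1 (by rw [one_pow, one_add_one_eq_two, h20])).1
    exact (mul_eq_zero.1 h2).resolve_left h20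
  -- Brahmagupta's identity: `(a² + c²)(b² + d²) = (ad - bc)² + (ab + cd)²`. If `b² + d² ≠ 0`,
  -- integral closedness then makes `p` a square.
  have h3 : p * (b ^ 2 + d ^ 2) ^ 2 = (a * d - b * c) ^ 2 := by
    linear_combination (-(b ^ 2 + d ^ 2)) * h1 + (a * b + c * d) * h2'
  have hbd : b ^ 2 + d ^ 2 = 0 := by
    by_contra hne
    obtain ⟨e, he⟩ := (IsIntegrallyClosed.pow_dvd_pow_iff two_ne_zero).1 (Dvd.intro_left p h3)
    refine hp ⟨e, mul_right_cancel₀ (pow_ne_zero 2 hne) ?_⟩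
    rw [h3, he]
    ring
  obtain ⟨rfl, rfl⟩ := hA b d hbd
  obtain ⟨rfl, rfl⟩ := hA a c (by simpa using h1)
  simp

theorem MvPolynomial.eq_zero_of_sq_add_sq_eq_zero {σ : Type*} {b d : MvPolynomial σ ℝ}
    (h : b ^ 2 + d ^ 2 = 0) : b = 0 ∧ d = 0 := by
  have key : ∀ x : σ → ℝ, MvPolynomial.eval x b = 0 ∧ MvPolynomial.eval x d = 0 := fun x => by
    have := congrArg (MvPolynomial.eval x) h
    simp only [map_add, map_pow, map_zero] at this
    constructor <;> nlinarith [sq_nonneg (MvPolynomial.eval x b), sq_nonneg (MvPolynomial.eval x d)]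
  exact ⟨MvPolynomial.funext fun x => by simp [(key x).1],
    MvPolynomial.funext fun x => by simp [(key x).2]⟩

/-- Killing all variables but one leaves `1 + X ^ 2`, which is not the square of a real linear
polynomial. -/
theorem not_isSquare_onePlusSumSq (n : ℕ) : ¬ IsSquare (onePlusSumSq (n + 1)) := by
  rintro ⟨q, hq⟩
  let r : Polynomial ℝ := MvPolynomial.aeval (fun i => if i = 0 then Polynomial.X else 0) q
  have hr : 1 + Polynomial.X ^ 2 = r * r := by
    have := congrArg (MvPolynomial.aeval (R := ℝ)
      (fun i : Fin (n + 1) => if i = 0 then (Polynomial.X : Polynomial ℝ) else 0)) hq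
    rw [map_mul] at this
    rw [← this]
    simp [onePlusSumSq, Fin.sum_univ_succ]
  have hd : r.natDegree ≤ 1 := by
    have h2 : (r * r).natDegree ≤ 2 := by
      rw [← hr]; compute_degree
    rw [← pow_two, Polynomial.natDegree_pow] at h2
    omega
  obtain ⟨b, a, h⟩ := Polynomial.exists_eq_X_add_C_of_natDegree_le_one hd
  have e0 := congrArg (Polynomial.eval 0) hr
  have e1 := congrArg (Polynomial.eval 1) hr
  have e2 := congrArg (Polynomial.eval (-1)) hr
  simp [h] at e0 e1 e2
  have hab : a * b = 0 := by linear_combination (e2 - e1) / 4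
  rcases mul_eq_zero.1 hab with rfl | rfl <;> nlinarith

theorem not_isSquare_neg_onePlusSumSq (n : ℕ) : ¬ IsSquare (-onePlusSumSq n) := by
  rintro ⟨q, hq⟩
  have := congrArg (MvPolynomial.eval 0) hq
  simp [onePlusSumSq] at this
  nlinarith [mul_self_nonneg (MvPolynomial.eval 0 q)]

theorem finSuccEquiv_onePlusSumSq (n : ℕ) :
    MvPolynomial.finSuccEquiv ℝ n (onePlusSumSq (n + 1)) =
      Polynomial.X ^ 2 + Polynomial.C (onePlusSumSq n) := by
  simp only [onePlusSumSq, Fin.sum_univ_succ, map_add, map_one, map_pow, map_sum,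
    MvPolynomial.finSuccEquiv_X_zero, MvPolynomial.finSuccEquiv_X_succ]
  ring

/-- As a monic quadratic in the first variable it could only split through a root, whose square
would be negative at the origin. -/
theorem irreducible_onePlusSumSq (n : ℕ) : Irreducible (onePlusSumSq (n + 1)) := by
  rw [← MulEquiv.irreducible_iff (MvPolynomial.finSuccEquiv ℝ n), finSuccEquiv_onePlusSumSq,
    (Polynomial.monic_X_pow_add_C _ two_ne_zero).irreducible_iff_roots_eq_zero_of_degree_le_three
      (by rw [Polynomial.natDegree_X_pow_add_C]) (by rw [Polynomial.natDegree_X_pow_add_C]; omega)]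
  refine Multiset.eq_zero_of_forall_notMem fun q hq => not_isSquare_neg_onePlusSumSq n ⟨q, ?_⟩
  have := (Polynomial.mem_roots'.1 hq).2
  simp only [Polynomial.IsRoot, Polynomial.eval_add, Polynomial.eval_pow, Polynomial.eval_X,
    Polynomial.eval_C] at this
  linear_combination -this

/-- Two variables are needed: in one variable `1 + X ^ 2` divides itself but not `X`. -/
theorem onePlusSumSq_dvd_of_dvd_sq_add_sq {n : ℕ} {g h : MvPolynomial (Fin (n + 2)) ℝ}
    (hgh : onePlusSumSq (n + 2) ∣ g ^ 2 + h ^ 2) : onePlusSumSq (n + 2) ∣ g := by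
  rw [← map_dvd_iff (MvPolynomial.finSuccEquiv ℝ (n + 1)), finSuccEquiv_onePlusSumSq] at hgh ⊢
  rw [map_add, map_pow, map_pow] at hgh
  exact Polynomial.X_sq_add_C_dvd_of_dvd_sq_add_sq
    (fun _ _ => MvPolynomial.eq_zero_of_sq_add_sq_eq_zero) (not_isSquare_onePlusSumSq n) hgh

/-! ### The valuation of a prime element -/

/-- The valuation of a domain that maps `g ≠ 0` to the multiplicity of the prime `f` in `g`. -/
noncomputable def multiplicityValuation {A : Type*} [CommRing A] [IsDomain A] [WfDvdMonoid A]
    {f : A} (hf : Prime f) : Valuation A ℤᵐ⁰ where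
  toFun g := open Classical in if g = 0 then 0 else WithZero.exp (-(multiplicity f g : ℤ))
  map_zero' := if_pos rfl
  map_one' := by
    rw [if_neg one_ne_zero, multiplicity_eq_zero.2 hf.not_dvd_one]
    simp
  map_mul' a b := by
    by_cases ha : a = 0
    · simp [ha]
    by_cases hb : b = 0
    · simp [hb]
    rw [if_neg ha, if_neg hb, if_neg (mul_ne_zero ha hb), ← WithZero.exp_add,
      multiplicity_mul hf (FiniteMultiplicity.of_not_isUnit hf.not_isUnit (mul_ne_zero ha hb))]
    push_cast
    rw [neg_add]
  map_add_le_max' a b := by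
    by_cases ha : a = 0
    · rw [ha, zero_add]
      exact le_max_right _ _
    by_cases hb : b = 0
    · rw [hb, add_zero]
      exact le_max_left _ _
    by_cases hab : a + b = 0
    · simp [hab]
    have hfin := FiniteMultiplicity.of_not_isUnit hf.not_isUnit hab
    rw [if_neg ha, if_neg hb, if_neg hab, le_max_iff, WithZero.exp_le_exp, WithZero.exp_le_exp]
    rcases le_total (multiplicity f a) (multiplicity f b) with h | h
    · left
      have := hfin.le_multiplicity_of_pow_dvd (dvd_add (pow_multiplicity_dvd f a)
        ((pow_dvd_pow f h).trans (pow_multiplicity_dvd f b)))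
      omega
    · right
      have := hfin.le_multiplicity_of_pow_dvd (dvd_add
        ((pow_dvd_pow f h).trans (pow_multiplicity_dvd f a)) (pow_multiplicity_dvd f b))
      omega

theorem multiplicityValuation_apply {A : Type*} [CommRing A] [IsDomain A] [WfDvdMonoid A] {f : A}
    (hf : Prime f) {g : A} (hg : g ≠ 0) :
    multiplicityValuation hf g = WithZero.exp (-(multiplicity f g : ℤ)) :=
  if_neg hg

section DeterminedBy

variable {A K : Type*} [CommRing A] [IsDomain A] [Field K] [Algebra A K] {f : A}

theorem exists_isValuationDeterminedBy [IsFractionRing A K] [WfDvdMonoid A] (hf : Prime f) :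
    ∃ w : Valuation K ℤᵐ⁰, IsValuationDeterminedBy f w := by
  have hS : nonZeroDivisors A ≤ (multiplicityValuation hf).supp.primeCompl := fun g hg h => by
    have h' : multiplicityValuation hf g = 0 := h
    rw [multiplicityValuation_apply hf (nonZeroDivisors.ne_zero hg)] at h'
    exact WithZero.exp_ne_zero h'
  refine ⟨(multiplicityValuation hf).extendToLocalization hS K, ?_, fun g hg => ?_⟩
  · rw [Valuation.extendToLocalization_apply_map_apply, multiplicityValuation_apply hf hf.ne_zero,
      multiplicity_self]
    rfl
  · rw [Valuation.extendToLocalization_apply_map_apply, multiplicityValuation_apply hf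
      (by rintro rfl; exact hg (dvd_zero f)), multiplicity_eq_zero.2 hg]
    simp

theorem IsValuationDeterminedBy.map_algebraMap [WfDvdMonoid A] (hf : ¬ IsUnit f)
    {w : Valuation K ℤᵐ⁰} (hw : IsValuationDeterminedBy f w) {g : A} (hg : g ≠ 0) :
    w (algebraMap A K g) = WithZero.exp (-1 : ℤ) ^ multiplicity f g := by
  obtain ⟨c, hc, hdvd⟩ :=
    (FiniteMultiplicity.of_not_isUnit hf hg).exists_eq_pow_mul_and_not_dvd
  conv_lhs => rw [hc]
  rw [map_mul, map_mul, map_pow, map_pow, hw.map_self, hw.map_of_not_dvd c hdvd, mul_one]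

theorem IsValuationDeterminedBy.map_algebraMap_le_one [WfDvdMonoid A] (hf : ¬ IsUnit f)
    {w : Valuation K ℤᵐ⁰} (hw : IsValuationDeterminedBy f w) (g : A) :
    w (algebraMap A K g) ≤ 1 := by
  by_cases hg : g = 0
  · simp [hg]
  · rw [hw.map_algebraMap hf hg]
    refine pow_le_one₀ zero_le ?_
    rw [← WithZero.exp_zero, WithZero.exp_le_exp]
    omega

theorem existsUnique_isValuationDeterminedBy [IsFractionRing A K] [WfDvdMonoid A] (hf : Prime f) :
    ∃! w : Valuation K ℤᵐ⁰, IsValuationDeterminedBy f w := by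
  obtain ⟨w, hw⟩ := exists_isValuationDeterminedBy (K := K) hf
  refine ⟨w, hw, fun w' hw' => Valuation.ext fun x => ?_⟩
  have key : ∀ g : A, w' (algebraMap A K g) = w (algebraMap A K g) := fun g => by
    by_cases hg : g = 0
    · simp [hg]
    · rw [hw.map_algebraMap hf.not_isUnit hg, hw'.map_algebraMap hf.not_isUnit hg]
  obtain ⟨g, h, -, rfl⟩ := IsFractionRing.div_surjective (A := A) x
  rw [map_div₀, map_div₀, key, key]

/-- If `-1` is not a square modulo `f`, then the valuation ring of `f` contains the minimal Dress
ring. -/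
theorem IsValuationDeterminedBy.minimalDressRing_le [IsFractionRing A K]
    [UniqueFactorizationMonoid A]
    (hf : ¬ IsUnit f) (hsq : ∀ g h : A, f ∣ g ^ 2 + h ^ 2 → f ∣ g)
    {w : Valuation K ℤᵐ⁰} (hw : IsValuationDeterminedBy f w) :
    minimalDressRing K ≤ w.valuationSubring.toSubring := by
  rw [minimalDressRing, Subring.closure_le]
  rintro _ ⟨x, rfl⟩
  change w (1 / (1 + x ^ 2)) ≤ 1
  by_contra! hlt
  have hx0 : 1 + x ^ 2 ≠ 0 := by
    rintro h0
    simp [h0] at hlt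
  obtain ⟨g, h, hrel, hx⟩ := IsFractionRing.exists_reduced_fraction (A := A) x
  have hh : algebraMap A K h ≠ 0 := IsFractionRing.to_map_ne_zero_of_mem_nonZeroDivisors h.2
  have hx' : x * algebraMap A K h = algebraMap A K g := by
    rw [← hx, IsLocalization.mk'_spec]
  -- In lowest terms `x = g / h`, a pole of `1 / (1 + x ^ 2)` puts `f` into `g ^ 2 + h ^ 2`, hence
  -- into both `g` and `h`.
  have hval : w (algebraMap A K (g ^ 2 + (h : A) ^ 2)) < 1 := by
    have : algebraMap A K (g ^ 2 + (h : A) ^ 2) = (1 + x ^ 2) * algebraMap A K h ^ 2 := by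
      rw [map_add, map_pow, map_pow, ← hx']
      ring
    rw [this, map_mul, map_pow]
    have h1 : w (1 + x ^ 2) < 1 := by
      rw [map_div₀, map_one, one_lt_div₀ (by simpa [zero_lt_iff] using hx0)] at hlt
      exact hlt
    calc _ ≤ w (1 + x ^ 2) := mul_le_of_le_one_right' (pow_le_one₀ zero_le
            (hw.map_algebraMap_le_one hf _))
      _ < 1 := h1
  have hdvd : f ∣ g ^ 2 + (h : A) ^ 2 := by
    by_contra hnd
    exact hval.ne (hw.map_of_not_dvd _ hnd)
  exact hf (hrel (hsq _ _ hdvd) (hsq _ _ (by rwa [add_comm])))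

end DeterminedBy

theorem IsValuationDeterminedBy.not_formallyReal_and_not_schultingRing_le {A K : Type*} [CommRing A]
    [Field K] [Algebra A K] {s : A} (hs : IsSumSq s) {w : Valuation K ℤᵐ⁰}
    (hw : IsValuationDeterminedBy (1 + s) w) :
    ¬ w.valuationSubring.FormallyReal ∧ ¬ schultingRing K ≤ w.valuationSubring.toSubring := by
  have hnot : (1 + algebraMap A K s)⁻¹ ∉ w.valuationSubring := fun h => by
    have h' : w (1 + algebraMap A K s)⁻¹ ≤ 1 := h
    rw [map_inv₀, ← map_one (algebraMap A K), ← map_add, hw.map_self, ← WithZero.exp_neg,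
      ← WithZero.exp_zero, WithZero.exp_le_exp] at h'
    omega
  have hs' := hs.map_ringHom (algebraMap A K)
  exact ⟨fun h => hnot (h.one_add_ne_zero_and_inv_mem hs').2,
    fun h => hnot (h (one_add_inv_mem_schultingRing hs'))⟩

/-! ### Real places of the rational functions in one variable -/

theorem Polynomial.leadingCoeff_add_nonneg {p q : Polynomial ℝ} (hp : 0 ≤ p.leadingCoeff)
    (hq : 0 ≤ q.leadingCoeff) : 0 ≤ (p + q).leadingCoeff ∧ p.degree ≤ (p + q).degree := by
  rcases lt_trichotomy p.degree q.degree with h | h | h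
  · rw [Polynomial.leadingCoeff_add_of_degree_lt h, Polynomial.degree_add_eq_right_of_degree_lt h]
    exact ⟨hq, h.le⟩
  · by_cases hp0 : p = 0
    · simp [hp0, hq]
    have hsum : 0 < p.leadingCoeff + q.leadingCoeff :=
      add_pos_of_pos_of_nonneg (hp.lt_of_ne' (Polynomial.leadingCoeff_ne_zero.2 hp0)) hq
    rw [Polynomial.leadingCoeff_add_of_degree_eq h hsum.ne',
      Polynomial.degree_add_eq_of_leadingCoeff_add_ne_zero hsum.ne']
    exact ⟨hsum.le, le_max_left _ _⟩
  · rw [Polynomial.leadingCoeff_add_of_degree_lt' h, Polynomial.degree_add_eq_left_of_degree_lt h]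
    exact ⟨hp, le_rfl⟩

section RationalFunctions

open Polynomial

variable (K : Type*) [Field K] [Algebra ℝ[X] K] [IsFractionRing ℝ[X] K]

/-- The valuation ring of the point at infinity: the quotients `g / h` with `deg g ≤ deg h`. -/
def valuationSubringAtInfinity : ValuationSubring K where
  carrier := {x | ∃ g h : ℝ[X], h ≠ 0 ∧ g.degree ≤ h.degree ∧
    x = algebraMap ℝ[X] K g / algebraMap ℝ[X] K h}
  zero_mem' := ⟨0, 1, one_ne_zero, by simp, by simp⟩
  one_mem' := ⟨1, 1, one_ne_zero, le_rfl, by simp⟩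
  neg_mem' := by
    rintro _ ⟨g, h, hh, hd, rfl⟩
    exact ⟨-g, h, hh, by rwa [degree_neg], by rw [map_neg, neg_div]⟩
  mul_mem' := by
    rintro _ _ ⟨g, h, hh, hd, rfl⟩ ⟨g', h', hh', hd', rfl⟩
    refine ⟨g * g', h * h', mul_ne_zero hh hh', ?_, by rw [map_mul, map_mul, div_mul_div_comm]⟩
    rw [degree_mul, degree_mul]
    exact add_le_add hd hd'
  add_mem' := by
    rintro _ _ ⟨g, h, hh, hd, rfl⟩ ⟨g', h', hh', hd', rfl⟩
    refine ⟨g * h' + h * g', h * h', mul_ne_zero hh hh', ?_, ?_⟩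
    · refine (degree_add_le _ _).trans (max_le ?_ ?_) <;> rw [degree_mul, degree_mul]
      · exact add_le_add_left hd _
      · exact add_le_add_right hd' _
    · rw [map_add, map_mul, map_mul, map_mul, div_add_div _ _ (by simpa using hh)
        (by simpa using hh')]
  mem_or_inv_mem' x := by
    obtain ⟨g, h, hh, rfl⟩ := IsFractionRing.div_surjective (A := ℝ[X]) x
    have hh := nonZeroDivisors.ne_zero hh
    by_cases hg : g = 0
    · exact Or.inl ⟨0, 1, one_ne_zero, by simp, by simp [hg]⟩
    rcases le_total g.degree h.degree with hd | hd
    · exact Or.inl ⟨g, h, hh, hd, rfl⟩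
    · exact Or.inr ⟨h, g, hg, hd, inv_div _ _⟩

variable {K}

theorem div_mem_valuationSubringAtInfinity_iff {g h : ℝ[X]} (hh : h ≠ 0) :
    algebraMap ℝ[X] K g / algebraMap ℝ[X] K h ∈ valuationSubringAtInfinity K ↔
      g.degree ≤ h.degree := by
  refine ⟨?_, fun hd => ⟨g, h, hh, hd, rfl⟩⟩
  rintro ⟨g', h', hh', hd, he⟩
  rw [div_eq_div_iff (by simpa using hh) (by simpa using hh'), ← map_mul, ← map_mul] at he
  have he' := congrArg degree (IsFractionRing.injective ℝ[X] K he)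
  by_contra! hlt
  have hdeg : (g' * h).degree < (g * h').degree := by
    rw [degree_mul, degree_mul, add_comm]
    calc h.degree + g'.degree ≤ h.degree + h'.degree := add_le_add_right hd _
      _ < g.degree + h'.degree := WithBot.add_lt_add_right (by simpa using hh') hlt
  exact hdeg.ne he'.symm

variable (K) in
-- Over a common denominator, `s = p / h ^ 2` with nonnegative leading coefficient of `p`, so
-- leading terms cannot cancel in `h ^ 2 + p`.
theorem valuationSubringAtInfinity_one_add_inv_mem (s : K) (hs : IsSumSq s) :
    1 + s ≠ 0 ∧ (1 + s)⁻¹ ∈ valuationSubringAtInfinity K := by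
  have hfrac : ∃ h p : ℝ[X], h ≠ 0 ∧ 0 ≤ p.leadingCoeff ∧
      s = algebraMap ℝ[X] K p / algebraMap ℝ[X] K (h ^ 2) := by
    induction hs with
    | zero => exact ⟨1, 0, one_ne_zero, by simp, by simp⟩
    | @sq_add a s _ ih =>
      obtain ⟨h, p, hh, hp, rfl⟩ := ih
      obtain ⟨g, k, hk, rfl⟩ := IsFractionRing.div_surjective (A := ℝ[X]) a
      have hk := nonZeroDivisors.ne_zero hk
      refine ⟨h * k, (g * h) ^ 2 + p * k ^ 2, mul_ne_zero hh hk,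
        (leadingCoeff_add_nonneg ?_ ?_).1, ?_⟩
      · rw [leadingCoeff_pow]
        positivity
      · rw [leadingCoeff_mul, leadingCoeff_pow]
        positivity
      · have hh' : algebraMap ℝ[X] K h ≠ 0 := by simpa using hh
        have hk' : algebraMap ℝ[X] K k ≠ 0 := by simpa using hk
        simp only [map_add, map_mul, map_pow]
        field_simp
  obtain ⟨h, p, hh, hp, rfl⟩ := hfrac
  have hdeg : (h ^ 2).degree ≤ (h ^ 2 + p).degree :=
    (leadingCoeff_add_nonneg (by rw [leadingCoeff_pow]; positivity) hp).2
  have hne : h ^ 2 + p ≠ 0 := by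
    intro h0
    rw [h0, degree_zero, le_bot_iff, degree_eq_bot] at hdeg
    exact hh (by simpa using hdeg)
  have heq : 1 + algebraMap ℝ[X] K p / algebraMap ℝ[X] K (h ^ 2) =
      algebraMap ℝ[X] K (h ^ 2 + p) / algebraMap ℝ[X] K (h ^ 2) := by
    have hh' : algebraMap ℝ[X] K (h ^ 2) ≠ 0 := by simpa using hh
    rw [map_add, add_div, div_self hh']
  rw [heq, inv_div, div_mem_valuationSubringAtInfinity_iff hne]
  exact ⟨div_ne_zero ((map_ne_zero_iff _ (IsFractionRing.injective ℝ[X] K)).2 hne)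
    (by simpa using hh), hdeg⟩

variable (K) in
theorem valuationSubringAtInfinity_formallyReal : (valuationSubringAtInfinity K).FormallyReal :=
  ValuationSubring.formallyReal_of_one_add_inv_mem (valuationSubringAtInfinity_one_add_inv_mem K)

variable (K) in
/-- The substitution `X ↦ a + 1 / X` on rational functions. -/
theorem exists_ringHom_X_eq_add_inv (a : ℝ) : ∃ σ : K →+* K,
    (∀ c : ℝ, σ (algebraMap ℝ[X] K (C c)) = algebraMap ℝ[X] K (C c)) ∧
    σ (algebraMap ℝ[X] K X) = algebraMap ℝ[X] K (C a) + (algebraMap ℝ[X] K X)⁻¹ := by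
  let _ : Algebra ℝ K := ((algebraMap ℝ[X] K).comp C).toAlgebra
  have hX : Transcendental ℝ (algebraMap ℝ[X] K X) := by
    rw [transcendental_iff_injective]
    have : ⇑(aeval (R := ℝ) (algebraMap ℝ[X] K X)) = algebraMap ℝ[X] K := by
      funext p
      rw [aeval_def, show algebraMap ℝ K = (algebraMap ℝ[X] K).comp C from rfl, ← hom_eval₂,
        eval₂_C_X]
    rw [this]
    exact IsFractionRing.injective ℝ[X] K
  have hY : Transcendental ℝ (algebraMap ℝ K a + (algebraMap ℝ[X] K X)⁻¹) := fun h => hX <| by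
    have := (h.sub (isAlgebraic_algebraMap a)).inv
    rwa [add_sub_cancel_left, inv_inv] at this
  rw [transcendental_iff_injective] at hY
  refine ⟨IsFractionRing.lift (A := ℝ[X]) (g := (aeval (R := ℝ)
    (algebraMap ℝ K a + (algebraMap ℝ[X] K X)⁻¹)).toRingHom) hY, fun c => ?_, ?_⟩
  · rw [IsFractionRing.lift_algebraMap]
    exact aeval_C _ _
  · rw [IsFractionRing.lift_algebraMap]
    exact aeval_X _

variable (K) in
-- The place at `a` is pulled back from infinity along `X ↦ a + 1 / X`.
theorem exists_formallyReal_valuationSubring_at (a : ℝ) : ∃ V : ValuationSubring K,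
    V.FormallyReal ∧ (∀ p : ℝ[X], algebraMap ℝ[X] K p ∈ V) ∧
      (algebraMap ℝ[X] K (X - C a))⁻¹ ∉ V := by
  obtain ⟨σ, hC, hX⟩ := exists_ringHom_X_eq_add_inv K a
  have hconst : ∀ c : ℝ, algebraMap ℝ[X] K (C c) ∈ valuationSubringAtInfinity K := fun c => by
    have := (div_mem_valuationSubringAtInfinity_iff (K := K) (g := C c) one_ne_zero).2
      (degree_C_le.trans degree_one.ge)
    simpa using this
  refine ⟨(valuationSubringAtInfinity K).comap σ,
    ValuationSubring.formallyReal_of_one_add_inv_mem fun s hs => ?_, fun p => ?_, fun h => ?_⟩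
  · have := valuationSubringAtInfinity_one_add_inv_mem K (σ s) (hs.map_ringHom σ)
    rw [← map_one σ, ← map_add, ← map_inv₀] at this
    exact ⟨fun h0 => this.1 (by rw [h0, map_zero]), this.2⟩
  · rw [ValuationSubring.mem_comap]
    induction p using Polynomial.induction_on' with
    | add p q hp hq =>
      rw [map_add, map_add]
      exact add_mem hp hq
    | monomial n c =>
      rw [← C_mul_X_pow_eq_monomial, map_mul, map_mul, map_pow, map_pow, hC, hX]
      refine mul_mem (hconst c) (pow_mem (add_mem (hconst a) ?_) n)
      have := (div_mem_valuationSubringAtInfinity_iff (K := K) (g := 1) (h := X) X_ne_zero).2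
        (by rw [degree_one, degree_X]; exact zero_le_one)
      simpa using this
  · rw [ValuationSubring.mem_comap, map_inv₀, map_sub, map_sub, hX, hC, add_sub_cancel_left,
      inv_inv] at h
    have := (div_mem_valuationSubringAtInfinity_iff (K := K) (g := X) (h := 1) one_ne_zero).1
      (by simpa using h)
    rw [degree_one, degree_X] at this
    exact absurd this (by decide)

/-- The denominator of a reduced fraction in the Schülting ring has no real zeros. -/
theorem eval_ne_zero_of_div_mem_schultingRing {g h : ℝ[X]} (hrel : IsRelPrime g h)
    (hmem : algebraMap ℝ[X] K g / algebraMap ℝ[X] K h ∈ schultingRing K) (hh : h ≠ 0) (a : ℝ) :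
    h.eval a ≠ 0 := by
  intro ha
  obtain ⟨V, hV, hpoly, hpole⟩ := exists_formallyReal_valuationSubring_at K a
  have hmemV : algebraMap ℝ[X] K g / algebraMap ℝ[X] K h ∈ V := by
    rw [schultingRing, Subring.mem_iInf] at hmem
    exact hmem ⟨V, hV⟩
  have hga : g.eval a ≠ 0 := fun hga =>
    not_isUnit_X_sub_C a (hrel (dvd_iff_isRoot.2 hga) (dvd_iff_isRoot.2 ha))
  obtain ⟨k, rfl⟩ := dvd_iff_isRoot.2 ha
  obtain ⟨q, hq⟩ := X_sub_C_dvd_sub_C_eval (a := a) (p := g)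
  rw [sub_eq_iff_eq_add] at hq
  obtain ⟨hl, hk⟩ := mul_ne_zero_iff.1 hh
  have hl' : algebraMap ℝ[X] K (X - C a) ≠ 0 :=
    (map_ne_zero_iff _ (IsFractionRing.injective ℝ[X] K)).2 hl
  have hk' : algebraMap ℝ[X] K k ≠ 0 := by simpa using hk
  refine hpole ?_
  -- With `g = (X - a) q + g(a)` and `h = (X - a) k`, one has `g(a) / (X - a) = (g / h) k - q`.
  have hinv : (algebraMap ℝ[X] K (X - C a))⁻¹ = algebraMap ℝ[X] K (C (g.eval a)⁻¹) *
      (algebraMap ℝ[X] K g / algebraMap ℝ[X] K ((X - C a) * k) * algebraMap ℝ[X] K k -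
        algebraMap ℝ[X] K q) := by
    have hc : algebraMap ℝ[X] K (C (g.eval a)⁻¹) * algebraMap ℝ[X] K (C (g.eval a)) = 1 := by
      rw [← map_mul, ← C_mul, inv_mul_cancel₀ hga, C_1, map_one]
    have hg : algebraMap ℝ[X] K g = algebraMap ℝ[X] K (X - C a) * algebraMap ℝ[X] K q +
        algebraMap ℝ[X] K (C (g.eval a)) := by
      rw [← map_mul, ← map_add, ← hq]
    refine inv_eq_of_mul_eq_one_right ?_
    rw [map_mul, ← hc]
    generalize algebraMap ℝ[X] K (C (g.eval a)⁻¹) = u at *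
    rw [hg]
    field_simp
    ring
  rw [hinv]
  exact V.mul_mem _ _ (hpoly _) (sub_mem (V.mul_mem _ _ hmemV (hpoly _)) (hpoly _))

end RationalFunctions

/-! ### Generating fractions inside the minimal Dress ring -/

theorem one_div_mem_minimalDressRing {K : Type*} [Field K] (x : K) :
    1 / (1 + x ^ 2) ∈ minimalDressRing K :=
  Subring.subset_closure ⟨x, rfl⟩

/-- Reals in `(0, 1]` have the form `1 / (1 + x ^ 2)`; integer multiples and signs give the rest. -/
theorem map_real_mem_minimalDressRing {K : Type*} [Field K] (ι : ℝ →+* K) (c : ℝ) :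
    ι c ∈ minimalDressRing K := by
  have hunit : ∀ c : ℝ, 0 < c → c ≤ 1 → ι c ∈ minimalDressRing K := fun c hc0 hc1 => by
    have hsq : c = 1 / (1 + √(1 / c - 1) ^ 2) := by
      rw [Real.sq_sqrt (by rw [sub_nonneg, le_div_iff₀ hc0]; linarith), add_sub_cancel,
        one_div_one_div]
    rw [hsq, map_div₀, map_add, map_one, map_pow]
    exact one_div_mem_minimalDressRing _
  have hpos : ∀ c : ℝ, 0 < c → ι c ∈ minimalDressRing K := fun c hc => by
    obtain ⟨n, hn⟩ := exists_nat_ge c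
    have hn0 : (0 : ℝ) < n := hc.trans_le hn
    rw [← mul_div_cancel₀ c hn0.ne', map_mul, map_natCast]
    exact mul_mem (natCast_mem _ n) (hunit _ (div_pos hc hn0) ((div_le_one hn0).2 hn))
  rcases lt_trichotomy c 0 with hc | rfl | hc
  · rw [← neg_neg c, map_neg]
    exact neg_mem (hpos _ (neg_pos.2 hc))
  · rw [map_zero]
    exact zero_mem _
  · exact hpos c hc

/-- The parametrization `x = (1 - y) / (1 + y)` puts `y / (1 + y ^ 2)` into the minimal Dress
ring. -/
theorem div_one_add_sq_mem_minimalDressRing {K : Type*} [Field K] (ι : ℝ →+* K) {y : K}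
    (hy : 1 + y ^ 2 ≠ 0) : y / (1 + y ^ 2) ∈ minimalDressRing K := by
  have : CharZero K := charZero_of_injective_ringHom ι.injective
  have hhalf : (1 / 2 : K) ∈ minimalDressRing K := by
    have := map_real_mem_minimalDressRing ι (1 / 2)
    rwa [map_div₀, map_one, map_ofNat] at this
  by_cases h : 1 + y = 0
  · rw [eq_neg_of_add_eq_zero_right h]
    have := neg_mem hhalf
    norm_num at this ⊢
    exact this
  · have h2 : 1 + ((1 - y) / (1 + y)) ^ 2 = 2 * (1 + y ^ 2) / (1 + y) ^ 2 := by
      field_simp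
      ring
    have heq : y / (1 + y ^ 2) = 1 / (1 + ((1 - y) / (1 + y)) ^ 2) - 1 / 2 := by
      rw [h2]
      field_simp
      ring
    rw [heq]
    exact sub_mem (one_div_mem_minimalDressRing _) hhalf

section RationalFunctions

open Polynomial

variable {K : Type*} [Field K] [Algebra ℝ[X] K] [IsFractionRing ℝ[X] K]

/-- The substitution `y = (x - a) / b` reduces to `1 / (1 + y ^ 2)` and `y / (1 + y ^ 2)`. -/
theorem div_mem_minimalDressRing_of_natDegree_le_one {b a : ℝ} (hb : b ≠ 0) {r : ℝ[X]}
    (hr : r.natDegree ≤ 1) :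
    algebraMap ℝ[X] K r / algebraMap ℝ[X] K ((X - C a) ^ 2 + C (b ^ 2)) ∈ minimalDressRing K := by
  obtain ⟨d, c, rfl⟩ := exists_eq_X_add_C_of_natDegree_le_one hr
  let ι : ℝ →+* K := (algebraMap ℝ[X] K).comp C
  let x : K := algebraMap ℝ[X] K X
  have hb' : ι b ≠ 0 := (map_ne_zero ι).2 hb
  have hq : algebraMap ℝ[X] K ((X - C a) ^ 2 + C (b ^ 2)) =
      ι b ^ 2 * (1 + ((x - ι a) / ι b) ^ 2) := by
    have : algebraMap ℝ[X] K ((X - C a) ^ 2 + C (b ^ 2)) = (x - ι a) ^ 2 + ι b ^ 2 := by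
      simp [x, ι]
    rw [this]
    field_simp
    ring
  have hq0 : 1 + ((x - ι a) / ι b) ^ 2 ≠ 0 := by
    have hne : (X - C a) ^ 2 + C (b ^ 2) ≠ 0 := fun h => by
      have := congrArg (eval a) h
      simp [hb] at this
    have := (map_ne_zero_iff _ (IsFractionRing.injective ℝ[X] K)).2 hne
    rw [hq] at this
    exact right_ne_zero_of_mul this
  have hr : algebraMap ℝ[X] K (C d * X + C c) =
      ι (d * b) * ((x - ι a) / ι b) + ι (d * a + c) := by
    have : algebraMap ℝ[X] K (C d * X + C c) = ι d * x + ι c := by simp [x, ι]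
    rw [this, map_mul, map_add, map_mul]
    field_simp
    ring
  rw [hq, hr]
  generalize (x - ι a) / ι b = y at *
  have heq : (ι (d * b) * y + ι (d * a + c)) / (ι b ^ 2 * (1 + y ^ 2)) =
      ι ((b ^ 2)⁻¹) * (ι (d * b) * (y / (1 + y ^ 2)) + ι (d * a + c) * (1 / (1 + y ^ 2))) := by
    rw [map_inv₀, map_pow]
    field_simp
  rw [heq]
  exact mul_mem (map_real_mem_minimalDressRing ι _) (add_mem
    (mul_mem (map_real_mem_minimalDressRing ι _) (div_one_add_sq_mem_minimalDressRing ι hq0))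
    (mul_mem (map_real_mem_minimalDressRing ι _) (one_div_mem_minimalDressRing y)))

/-- A real polynomial of positive degree without real zeros has a factor `(X - a) ^ 2 + b ^ 2`. -/
theorem exists_quadratic_dvd {h : ℝ[X]} (hdeg : 0 < h.natDegree) (hroot : ∀ a, h.eval a ≠ 0) :
    ∃ a b : ℝ, b ≠ 0 ∧ (X - C a) ^ 2 + C (b ^ 2) ∣ h := by
  obtain ⟨p, hpm, hp, hph⟩ := exists_monic_irreducible_factor h
    (fun hu => by rw [natDegree_eq_zero_of_isUnit hu] at hdeg; exact hdeg.false)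
  have hproot : ∀ a, p.eval a ≠ 0 := fun a ha => hroot a (by
    obtain ⟨k, rfl⟩ := hph
    rw [eval_mul, ha, zero_mul])
  have hle : p.natDegree ≤ 2 := natDegree_le_of_degree_le hp.degree_le_two
  have hpos : 0 < p.natDegree := hp.natDegree_pos
  have h2 : p.natDegree = 2 := by
    by_contra h2
    obtain ⟨a, ha⟩ := exists_root_of_degree_eq_one
      ((degree_eq_iff_natDegree_eq_of_pos one_pos).2 (by omega : p.natDegree = 1))
    exact hproot a ha
  have hp2 : p = X ^ 2 + C (p.coeff 1) * X + C (p.coeff 0) := by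
    have h1 : p.coeff 2 = 1 := by rw [← h2]; exact hpm.coeff_natDegree
    conv_lhs => rw [p.as_sum_range_C_mul_X_pow, h2]
    simp [Finset.sum_range_succ, h1]
    ring
  generalize p.coeff 1 = u at hp2
  generalize p.coeff 0 = v at hp2
  have hdisc : 0 < v - u ^ 2 / 4 := by
    by_contra! hneg
    refine hproot (-u / 2 + √(u ^ 2 / 4 - v)) ?_
    have := Real.sq_sqrt (by linarith : 0 ≤ u ^ 2 / 4 - v)
    rw [hp2]
    simp only [eval_add, eval_pow, eval_X, eval_mul, eval_C]
    linear_combination this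
  refine ⟨-u / 2, √(v - u ^ 2 / 4), (Real.sqrt_pos.2 hdisc).ne', ?_⟩
  rw [Real.sq_sqrt hdisc.le]
  convert hph using 1
  rw [hp2]
  refine Polynomial.funext fun t => ?_
  simp only [eval_add, eval_sub, eval_pow, eval_X, eval_mul, eval_C]
  ring

/-- Induction on the degree of `h = q k`, with `q` quadratic: dividing `g` by `q` leaves fractions
over `k` and a remainder over `q`. -/
theorem div_mem_minimalDressRing (N : ℕ) : ∀ g h : ℝ[X], h.natDegree ≤ N → (∀ a, h.eval a ≠ 0) →
    g.natDegree ≤ h.natDegree →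
    algebraMap ℝ[X] K g / algebraMap ℝ[X] K h ∈ minimalDressRing K := by
  induction N with
  | zero =>
    intro g h hN hroot hgh
    rw [eq_C_of_natDegree_eq_zero (Nat.le_zero.1 hN),
      eq_C_of_natDegree_eq_zero (Nat.le_zero.1 (hgh.trans hN))]
    have := map_real_mem_minimalDressRing ((algebraMap ℝ[X] K).comp C) (g.coeff 0 / h.coeff 0)
    rwa [map_div₀] at this
  | succ N ih =>
    intro g h hN hroot hgh
    by_cases hdeg : h.natDegree = 0
    · exact ih g h (by omega) hroot hgh
    obtain ⟨a, b, hb, k, rfl⟩ := exists_quadratic_dvd (by omega) hroot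
    set q : ℝ[X] := (X - C a) ^ 2 + C (b ^ 2) with hq
    have hk : k ≠ 0 := by rintro rfl; simp at hdeg
    have hqd : q.natDegree = 2 := by rw [hq]; compute_degree!
    have hqm : q.Monic := by rw [hq]; monicity!
    have hkroot : ∀ a, k.eval a ≠ 0 := fun a h0 => hroot a (by rw [eval_mul, h0, mul_zero])
    rw [natDegree_mul hqm.ne_zero hk, hqd] at hN hgh
    have hq' : algebraMap ℝ[X] K q ≠ 0 :=
      (map_ne_zero_iff _ (IsFractionRing.injective ℝ[X] K)).2 hqm.ne_zero
    have hk' : algebraMap ℝ[X] K k ≠ 0 :=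
      (map_ne_zero_iff _ (IsFractionRing.injective ℝ[X] K)).2 hk
    have hrem : (g %ₘ q).natDegree ≤ 1 := by
      have := natDegree_modByMonic_lt g hqm (fun h => by simp [h] at hqd)
      omega
    have heq : algebraMap ℝ[X] K g / algebraMap ℝ[X] K (q * k) =
        algebraMap ℝ[X] K (g /ₘ q) / algebraMap ℝ[X] K k +
        algebraMap ℝ[X] K (g %ₘ q) / algebraMap ℝ[X] K q *
          (algebraMap ℝ[X] K 1 / algebraMap ℝ[X] K k) := by
      conv_lhs => rw [← modByMonic_add_div g q]
      rw [map_one, map_add, map_mul, map_mul]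
      field_simp
      ring
    rw [heq]
    refine add_mem (ih _ _ (by omega) hkroot ?_) (mul_mem
      (div_mem_minimalDressRing_of_natDegree_le_one hb hrem) (ih _ _ (by omega) hkroot (by simp)))
    rw [natDegree_divByMonic g hqm]
    omega

variable (K) in
theorem schultingRing_eq_minimalDressRing : schultingRing K = minimalDressRing K := by
  refine le_antisymm (fun x hx => ?_) (minimalDressRing_le_schultingRing K)
  obtain ⟨g, h, hrel, rfl⟩ := IsFractionRing.exists_reduced_fraction (A := ℝ[X]) x
  rw [IsFractionRing.mk'_eq_div] at hx ⊢
  have hh : (h : ℝ[X]) ≠ 0 := nonZeroDivisors.ne_zero h.2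
  have hroot := eval_ne_zero_of_div_mem_schultingRing hrel hx hh
  rw [schultingRing, Subring.mem_iInf] at hx
  have hdeg := (div_mem_valuationSubringAtInfinity_iff hh).1
    (hx ⟨_, valuationSubringAtInfinity_formallyReal K⟩)
  exact div_mem_minimalDressRing _ g h le_rfl hroot (natDegree_le_natDegree hdeg)

end RationalFunctions

/-! ### The theorem for `MvPolynomial` -/

theorem schultingRing_eq_minimalDressRing_of_one (K : Type*) [Field K]
    [Algebra (MvPolynomial (Fin 1) ℝ) K] [IsFractionRing (MvPolynomial (Fin 1) ℝ) K] :
    schultingRing K = minimalDressRing K := by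
  let e : MvPolynomial (Fin 1) ℝ ≃+* Polynomial ℝ :=
    (MvPolynomial.uniqueAlgEquiv ℝ (Fin 1)).toRingEquiv
  let _ : Algebra (Polynomial ℝ) K :=
    ((algebraMap (MvPolynomial (Fin 1) ℝ) K).comp e.symm.toRingHom).toAlgebra
  have : IsFractionRing (Polynomial ℝ) K := by
    have := IsLocalization.isLocalization_of_base_ringEquiv
      (nonZeroDivisors (MvPolynomial (Fin 1) ℝ)) K e
    rwa [MulEquivClass.map_nonZeroDivisors] at this
  exact schultingRing_eq_minimalDressRing K

theorem mainTheorem5 (n : ℕ) (K : Type*) [Field K] [Algebra (MvPolynomial (Fin n) ℝ) K]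
    [IsFractionRing (MvPolynomial (Fin n) ℝ) K] :
    (n = 1 → schultingRing K = minimalDressRing K) ∧
    (2 ≤ n →
      minimalDressRing K < schultingRing K ∧
      Irreducible (onePlusSumSq n) ∧
      (∃! w : Valuation K ℤᵐ⁰, IsValuationDeterminedBy (onePlusSumSq n) w) ∧
      ∀ w : Valuation K ℤᵐ⁰, IsValuationDeterminedBy (onePlusSumSq n) w →
        minimalDressRing K ≤ w.valuationSubring.toSubring ∧
        ¬ w.valuationSubring.FormallyReal ∧
        ¬ schultingRing K ≤ w.valuationSubring.toSubring) := by
  refine ⟨?_, fun hn => ?_⟩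
  · rintro rfl
    exact schultingRing_eq_minimalDressRing_of_one K
  · obtain ⟨m, rfl⟩ := Nat.exists_eq_add_of_le' hn
    have hirr := irreducible_onePlusSumSq (m + 1)
    have hw : ∀ w : Valuation K ℤᵐ⁰, IsValuationDeterminedBy (onePlusSumSq (m + 2)) w →
        minimalDressRing K ≤ w.valuationSubring.toSubring ∧
        ¬ w.valuationSubring.FormallyReal ∧
        ¬ schultingRing K ≤ w.valuationSubring.toSubring := fun w hw =>
      ⟨hw.minimalDressRing_le hirr.not_isUnit fun _ _ => onePlusSumSq_dvd_of_dvd_sq_add_sq,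
        IsValuationDeterminedBy.not_formallyReal_and_not_schultingRing_le
          (IsSumSq.sum_sq Finset.univ _) hw⟩
    have hex := existsUnique_isValuationDeterminedBy (K := K) hirr.prime
    obtain ⟨w, hdet⟩ := hex.exists
    exact ⟨lt_of_le_not_ge (minimalDressRing_le_schultingRing K)
      fun hle => (hw w hdet).2.2 (hle.trans (hw w hdet).1), hirr, hex, hw⟩
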